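/- Let $\Gamma$ be a finite group acting on a compact metric space $X$ by homeomorphisms $(T_\gamma)_{\gamma\in\Gamma}$, i.e. $T:\Gamma\to\mathrm{Homeo}(X)$ is a homomorphism. Assume that the action is free: $T_\gamma(x)\neq T_{\gamma'}(x)$ for every $x\in X$ and all distinct $\gamma,\gamma'\in\Gamma$. For a finite collection $\mathcal V$ of subsets of $X$ and $x\in X$ put $\mathrm{ord}(\mathcal V,x)=-1+\sum_{V\in\mathcal V}\mathbf 1_V(x)$. Let $\mathrm{Cov}(X)$ be the set of finite open covers of $X$, write $\mathcal V\succeq\mathcal U$ if every element of $\mathcal V$ is contained in some element of $\mathcal U$, and let $\mathrm{Prob}(X,T)$ be the set of $T$-invariant Borel probability measures on $X$. For an open cover $\mathcal U$ let $$\dim(\mathcal U)=\inf_{\mathcal V\in\mathrm{Cov}(X),\,\mathcal V\succeq\mathcal U}\ \sup_{x\in X}\mathrm{ord}(\mathcal V,x),$$ let $\dim(X)=\sup_{\mathcal U\in\mathrm{Cov}(X)}\dim(\mathcal U)$ be the Lebesgue covering dimension, and let $$\dim(X,T)=\sup_{\mathcal U\in\mathrm{Cov}(X)}\ \inf_{\mathcal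 V\in\mathrm{Cov}(X),\,\mathcal V\succeq\mathcal U}\ \sup_{\mu\in\mathrm{Prob}(X,T)}\int_X\mathrm{ord}(\mathcal V,x)\,d\mu(x).$$ All values are taken in $[-\infty,+\infty]$ (with $\sup\emptyset=-\infty$, so that both dimensions are $-\infty$ for $X=\emptyset$). Then $$\dim(X,T)=\frac{1}{|\Gamma|}\dim(X).$$ Moreover, $\dim(X,T)$ equals the mean dimension of $(X,T)$: for every Følner sequence $(F_n)$ in $\Gamma$ and every $\mathcal U\in\mathrm{Cov}(X)$ the limit below exists in $[-\infty,+\infty]$, and $$\dim(X,T)=\mathrm{mdim}(X,T):=\sup_{\mathcal U\in\mathrm{Cov}(X)}\ \lim_{n\to\infty}\frac{1}{|F_n|}\dim\Big(\bigvee_{\gamma\in F_n}T_\gamma(\mathcal U)\Big),$$ where $\bigvee_{\gamma\in F}T_\gamma(\mathcal U)$ is the cover by the sets $\bigcap_{\gamma\in F}T_\gamma(U_\gamma)$ with $U_\gamma\in\mathcal U$. -/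

import Mathlib

open MeasureTheory Filter Topology

noncomputable section

namespace MeasDim

variable {X : Type*} {Γ : Type*}

/-- `𝓥` is a finite open cover of `X`. -/
def IsOpenCover [TopologicalSpace X] (𝓥 : Finset (Set X)) : Prop :=
  (∀ V ∈ 𝓥, IsOpen V) ∧ ∀ x : X, ∃ V ∈ 𝓥, x ∈ V

/-- `𝓥` refines `𝓤`: every element of `𝓥` is contained in some element of `𝓤`. -/
def Refines (𝓥 𝓤 : Set (Set X)) : Prop :=
  ∀ V ∈ 𝓥, ∃ U ∈ 𝓤, V ⊆ U

/-- The order of a finite collection at a point: `-1 + ∑_{V ∈ 𝓥} 1_V(x)`. -/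
def ordAt (𝓥 : Finset (Set X)) (x : X) : ℝ :=
  -1 + ∑ V ∈ 𝓥, V.indicator (fun _ => (1 : ℝ)) x

/-- `ord(𝓥) = sup_x ord(𝓥, x)`, which is `-∞` when `X` is empty. -/
def ord (𝓥 : Finset (Set X)) : EReal :=
  ⨆ x : X, (ordAt 𝓥 x : EReal)

/-- `dim(𝓤)`: the infimum of `ord(𝓥)` over the finite open covers `𝓥` that refine `𝓤`. -/
def coverDim [TopologicalSpace X] (𝓤 : Set (Set X)) : EReal :=
  ⨅ (𝓥 : Finset (Set X)) (_ : IsOpenCover 𝓥) (_ : Refines (𝓥 : Set (Set X)) 𝓤), ord 𝓥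

/-- The Lebesgue covering dimension, the supremum of `dim(𝓤)` over the finite open covers `𝓤`.
It is `-∞` for the empty space. -/
def coveringDim (X : Type*) [TopologicalSpace X] : EReal :=
  ⨆ (𝓤 : Finset (Set X)) (_ : IsOpenCover 𝓤), coverDim (𝓤 : Set (Set X))

/-- `ord(𝓥, P) = sup_{μ ∈ P} ∫ ord(𝓥, x) dμ(x)`, which is `-∞` when `P` is empty. -/
def ordPair [MeasurableSpace X] (𝓥 : Finset (Set X)) (P : Set (ProbabilityMeasure X)) : EReal :=
  ⨆ μ ∈ P, ((∫ x, ordAt 𝓥 x ∂(μ : Measure X) : ℝ) : EReal)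

/-- `dim(𝓤, P)`: the infimum of `ord(𝓥, P)` over the finite open covers `𝓥` that refine `𝓤`. -/
def coverDimPair [TopologicalSpace X] [MeasurableSpace X] (𝓤 : Set (Set X))
    (P : Set (ProbabilityMeasure X)) : EReal :=
  ⨅ (𝓥 : Finset (Set X)) (_ : IsOpenCover 𝓥) (_ : Refines (𝓥 : Set (Set X)) 𝓤), ordPair 𝓥 P

/-- `dim(X, P)`: the supremum of `dim(𝓤, P)` over the finite open covers `𝓤` of `X`.
It is `-∞` when `P` is empty. -/
def dimPair [TopologicalSpace X] [MeasurableSpace X] (P : Set (ProbabilityMeasure X)) : EReal :=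
  ⨆ (𝓤 : Finset (Set X)) (_ : IsOpenCover 𝓤), coverDimPair (𝓤 : Set (Set X)) P

/-- `Prob(X, T)`: the `T`-invariant Borel probability measures on `X`. -/
def invProb [TopologicalSpace X] [MeasurableSpace X] [Group Γ] (T : Γ →* (X ≃ₜ X)) :
    Set (ProbabilityMeasure X) :=
  {μ | ∀ γ : Γ, Measure.map (T γ) (μ : Measure X) = (μ : Measure X)}

/-- The dimension `dim(X, T) = dim(X, Prob(X, T))` of a dynamical system. -/
def dimSystem [TopologicalSpace X] [MeasurableSpace X] [Group Γ] (T : Γ →* (X ≃ₜ X)) : EReal :=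
  dimPair (invProb T)

/-- The action is free: distinct group elements move every point to distinct points. -/
def IsFreeAction [TopologicalSpace X] [Group Γ] (T : Γ →* (X ≃ₜ X)) : Prop :=
  ∀ (x : X) (γ γ' : Γ), γ ≠ γ' → T γ x ≠ T γ' x

/-- The joint refinement `⋁_{γ ∈ F} T_γ(𝓤)`: all sets `⋂_{γ ∈ F} T_γ(U_γ)` with `U_γ ∈ 𝓤`. -/
def join [TopologicalSpace X] [Group Γ] (T : Γ →* (X ≃ₜ X)) (F : Finset Γ)
    (𝓤 : Set (Set X)) : Set (Set X) :=
  {W | ∃ U : Γ → Set X, (∀ γ ∈ F, U γ ∈ 𝓤) ∧ W = ⋂ γ ∈ F, T γ '' U γ}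

/-- A Følner sequence of finite subsets of the discrete group `Γ`: the sets are eventually
nonempty, and `|γ F_n ∆ F_n| / |F_n|` tends to `0` for every `γ`. -/
def IsFolnerSeq [Group Γ] (F : ℕ → Finset Γ) : Prop :=
  letI : MeasurableSpace Γ := ⊤
  IsFoelner Γ (Measure.count : Measure Γ) atTop (fun n => (F n : Set Γ))

/-- The quantity `|F|⁻¹ dim(⋁_{γ ∈ F} T_γ(𝓤))`. -/
def avgCoverDim [TopologicalSpace X] [Group Γ] (T : Γ →* (X ≃ₜ X)) (𝓤 : Set (Set X))
    (F : Finset Γ) : EReal :=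
  coverDim (join T F 𝓤) / (F.card : EReal)

/-- Mean dimension computed along the sequence `F`: the supremum over the finite open covers `𝓤`
of the upper limit of `|F_n|⁻¹ dim(⋁_{γ ∈ F_n} T_γ(𝓤))`. When these sequences converge, as they do
along Følner sequences, the upper limit is the limit. -/
def meanDim [TopologicalSpace X] [Group Γ] (T : Γ →* (X ≃ₜ X)) (F : ℕ → Finset Γ) : EReal :=
  ⨆ (𝓤 : Finset (Set X)) (_ : IsOpenCover 𝓤),
    limsup (fun n => avgCoverDim T (𝓤 : Set (Set X)) (F n)) atTop

end MeasDim

end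

/-!
The orbits of `Γ` carry invariant probability measures, so the supremum of `∫ ord(𝓥, x) dμ(x)` over
the invariant `μ` is the largest average of `ord(𝓥, ·)` along an orbit. Both inequalities thus
concern the multiplicity at `x` of the family of all translates `T_γ⁻¹(V)`, counted with indices:
the sum of `ord(𝓥, ·)` over the orbit of `x` is this multiplicity minus `|Γ|`.

*Lower bound.* If the translates of the members of `𝓥` have multiplicity at most `|Γ| + n`, then
sorting bump functions on them by their values produces a refinement of `𝓥` of order at most `n`.

*Upper bound.* Let `dim X = n`. Small open sets have disjoint translates, and can be shrunk so that
their translates still cover `X`, now with multiplicity at most `n + 1`. Take bump functions on the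
shrunken sets, multiply their translates by generic constants and divide by the pointwise maximum
`m`. On the orbit of `x`, the pairs consisting of a point and a function attaining `m` there are the
edges of a bipartite graph, joining the `|Γ|` values of `m` to the at most `n + 1` positive values
of bump functions. Taking logarithms, a cycle would be a linear relation between the generic
constants; hence there are at most `|Γ| + n` edges. So the translates of the sets on which the
quotients exceed a level slightly below `1` have multiplicity at most `|Γ| + n`.

*Mean dimension.* A Følner sequence in a finite group is eventually equal to the whole group.
-/

namespace MeasDim

variable {X Γ : Type*}

/-! ### Linear independence and ties -/

section Ties

open Module Cardinal

theorem exists_linearIndependent_of_aleph0_le_rank {K V : Type*} [DivisionRing K] [AddCommGroup V]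
    [Module K V] (hV : ℵ₀ ≤ Module.rank K V) (ι : Type*) [Finite ι] :
    ∃ v : ι → V, LinearIndependent K v := by
  obtain ⟨s, hs, hlin⟩ := le_rank_iff_exists_linearIndependent_finset.1
    ((natCast_le_aleph0 (n := Nat.card ι)).trans hV)
  obtain ⟨e⟩ : Nonempty (ι ≃ s) := Finite.card_eq.1 (by simp [hs])
  exact ⟨_, hlin.comp e e.injective⟩

/-- Independence of the values `a i - b j` along the edges of a bipartite graph forces the graph to
be a forest, since these values sum to zero with alternating signs around a cycle. -/
theorem card_lt_of_linearIndependent_sub {K V ε α β : Type*} [DivisionRing K] [AddCommGroup V]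
    [Module K V] [Finite ε] [Finite α] [Finite β] [Nonempty β] (i : ε → α) (j : ε → β)
    {a : α → V} {b : β → V} (h : LinearIndependent K fun e ↦ a (i e) - b (j e)) :
    Nat.card ε < Nat.card α + Nat.card β := by
  classical
  have := Fintype.ofFinite ε
  have := Fintype.ofFinite α
  have := Fintype.ofFinite β
  obtain ⟨j₀⟩ := ‹Nonempty β›
  let w : α ⊕ {j // j ≠ j₀} → V := Sum.elim (fun i ↦ a i - b j₀) (fun j ↦ b j - b j₀)
  have hspan : Set.range (fun e ↦ a (i e) - b (j e)) ⊆ Submodule.span K (Set.range w) := by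
    rintro _ ⟨e, rfl⟩
    have ha : a (i e) - b j₀ ∈ Submodule.span K (Set.range w) :=
      Submodule.subset_span ⟨.inl (i e), rfl⟩
    have hb : b (j e) - b j₀ ∈ Submodule.span K (Set.range w) := by
      by_cases hj : j e = j₀
      · simp [hj]
      · exact Submodule.subset_span ⟨.inr ⟨j e, hj⟩, rfl⟩
    simpa using sub_mem ha hb
  have := FiniteDimensional.span_of_finite K (Set.finite_range w)
  have hcard : Fintype.card ε ≤ Fintype.card (α ⊕ {j // j ≠ j₀}) :=
    calc Fintype.card ε = Set.finrank K (Set.range fun e ↦ a (i e) - b (j e)) :=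
          (finrank_span_eq_card h).symm
      _ ≤ Set.finrank K (Set.range w) := Submodule.finrank_mono (Submodule.span_le.2 hspan)
      _ ≤ _ := finrank_range_le_card w
  have hβ : 0 < Fintype.card β := Fintype.card_pos_iff.2 ⟨j₀⟩
  simp only [Fintype.card_sum, ne_eq, Fintype.card_subtype_compl, Fintype.card_unique] at hcard
  simp only [Nat.card_eq_fintype_card]
  omega

theorem ncard_ties_lt {S : Type*} [Group Γ] [Finite Γ] [Finite S] {b : Γ × S → ℝ}
    (hb : LinearIndependent ℚ b) {u : Γ × S → ℝ} (hpos : ∃ p, 0 < u p)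
    (hu : ∀ s γ δ, 0 < u (γ, s) → 0 < u (δ, s) → γ = δ) {m : Γ → ℝ} (hm : ∀ δ, 0 < m δ) :
    {q : Γ × Γ × S | Real.exp (b q.2) * u (q.2.1 * q.1, q.2.2) = m q.1}.ncard <
      Nat.card Γ + {p | 0 < u p}.ncard := by
  set E := {q : Γ × Γ × S | Real.exp (b q.2) * u (q.2.1 * q.1, q.2.2) = m q.1}
  have huE (q : E) : 0 < u (q.1.2.1 * q.1.1, q.1.2.2) :=
    (mul_pos_iff_of_pos_left (Real.exp_pos _)).1 (q.2.symm ▸ hm q.1.1)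
  let e (q : E) : {p | 0 < u p} := ⟨_, huE q⟩
  have hinj : Function.Injective fun q : E ↦ q.1.2 := by
    rintro ⟨⟨δ, γ, s⟩, hq⟩ ⟨⟨δ', γ', s'⟩, hq'⟩ heq
    obtain ⟨rfl, rfl⟩ : γ = γ' ∧ s = s' := by simpa using heq
    obtain rfl := mul_left_cancel (hu s _ _ (huE ⟨_, hq⟩) (huE ⟨_, hq'⟩))
    rfl
  have hlog (q : E) : Real.log (m q.1.1) - Real.log (u (e q)) = b q.1.2 := by
    rw [← q.2, Real.log_mul (Real.exp_pos _).ne' (huE q).ne', Real.log_exp, add_sub_cancel_right]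
  have : Nonempty {p | 0 < u p} := nonempty_subtype.2 hpos
  have hlin : LinearIndependent ℚ fun q : E ↦ Real.log (m q.1.1) - Real.log (u (e q)) := by
    simpa only [hlog, Function.comp_def] using hb.comp _ hinj
  exact card_lt_of_linearIndependent_sub (fun q : E ↦ q.1.1) e (a := fun δ ↦ Real.log (m δ))
    (b := fun p ↦ Real.log (u p)) hlin

end Ties

/-! ### Multiplicity of indexed families -/

section Multiplicity

variable {J : Type*}

/-- The multiplicity of an indexed family at a point: the number of indices `j` with `x ∈ A j`.
Unlike in `ordAt`, coinciding members are counted separately. It is used for finite `J`, since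
`Set.ncard` is `0` on infinite sets. -/
noncomputable def mult (A : J → Set X) (x : X) : ℕ :=
  {j | x ∈ A j}.ncard

theorem mult_mono [Finite J] {Y : Type*} {A : J → Set X} {B : J → Set Y} {x : X} {y : Y}
    (h : ∀ j, x ∈ A j → y ∈ B j) : mult A x ≤ mult B y :=
  Set.ncard_le_ncard h

theorem mult_pos [Finite J] {A : J → Set X} {x : X} {j : J} (h : x ∈ A j) : 0 < mult A x :=
  (Set.ncard_pos).2 ⟨j, h⟩

theorem exists_forall_mult_le [Finite J] [Nonempty X] (A : J → Set X) :
    ∃ x₀, ∀ x, mult A x ≤ mult A x₀ := by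
  have hbdd : BddAbove (Set.range (mult A)) :=
    ⟨Nat.card J, Set.forall_mem_range.2 fun x ↦ Set.ncard_le_card _⟩
  obtain ⟨x₀, hx₀⟩ := Nat.sSup_mem (Set.range_nonempty (mult A)) hbdd
  exact ⟨x₀, fun x ↦ hx₀ ▸ le_csSup hbdd ⟨x, rfl⟩⟩

theorem ordAt_eq_mult_sub_one (𝓥 : Finset (Set X)) (x : X) :
    ordAt 𝓥 x = mult ((↑) : 𝓥 → Set X) x - 1 := by
  classical
  have hmult : mult ((↑) : 𝓥 → Set X) x = (𝓥.filter fun V ↦ x ∈ V).card := by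
    rw [mult, ← Set.ncard_image_of_injective _ Subtype.val_injective, ← Set.ncard_coe_finset]
    congr 1
    ext V
    simp [and_comm]
  rw [hmult, Finset.card_filter, ordAt]
  push_cast
  rw [neg_add_eq_sub]
  rfl

theorem ordAt_le_natCast_iff {𝓥 : Finset (Set X)} {x : X} {n : ℕ} :
    ordAt 𝓥 x ≤ n ↔ mult ((↑) : 𝓥 → Set X) x ≤ n + 1 := by
  rw [ordAt_eq_mult_sub_one, sub_le_iff_le_add]
  norm_cast

theorem ordAt_toFinset_range_le [Finite J] (A : J → Set X) (x : X) :
    ordAt (Set.finite_range A).toFinset x ≤ mult A x - 1 := by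
  rw [ordAt_eq_mult_sub_one, sub_le_sub_iff_right, Nat.cast_le]
  choose f hf using fun V : (Set.finite_range A).toFinset ↦ (Set.finite_range A).mem_toFinset.1 V.2
  refine Set.ncard_le_ncard_of_injOn f (fun V hV ↦ ?_) fun V _ W _ hVW ↦ ?_
  · rwa [Set.mem_ofPred_eq, hf V]
  · rw [← Subtype.coe_inj, ← hf V, ← hf W, hVW]

theorem isOpenCover_toFinset_range [TopologicalSpace X] [Finite J] {A : J → Set X}
    (hA : ∀ j, IsOpen (A j)) (hcov : ∀ x, ∃ j, x ∈ A j) :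
    IsOpenCover (Set.finite_range A).toFinset := by
  simpa [IsOpenCover] using ⟨hA, hcov⟩

/-- Superlevel sets of continuous functions on a compact space vary upper semicontinuously with the
level, so lowering the level slightly does not raise the maximal multiplicity. -/
theorem eventually_mult_superlevel_le [TopologicalSpace X] [CompactSpace X] [Finite J]
    {h : J → X → ℝ} (hc : ∀ j, Continuous (h j)) {c : ℝ} {n : ℕ}
    (hn : ∀ x, mult (fun j ↦ {y | c ≤ h j y}) x ≤ n) :
    ∀ᶠ r in 𝓝 c, ∀ x, mult (fun j ↦ {y | r < h j y}) x ≤ n := by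
  suffices ∀ᶠ r in 𝓝 c, ∀ x ∈ Set.univ, mult (fun j ↦ {y | r < h j y}) x ≤ n by simpa using this
  refine isCompact_univ.eventually_forall_of_forall_eventually fun x _ ↦ ?_
  have hlevel (j : J) : ∀ᶠ z : ℝ × X in 𝓝 (c, x), z.1 < h j z.2 → c ≤ h j x := by
    by_cases hj : c ≤ h j x
    · exact .of_forall fun _ _ ↦ hj
    · have hopen : IsOpen {z : ℝ × X | h j z.2 < z.1} :=
        isOpen_lt ((hc j).comp continuous_snd) continuous_fst
      filter_upwards [hopen.mem_nhds (not_le.1 hj)] with z hz hz'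
      exact (lt_asymm hz hz').elim
  filter_upwards [eventually_all.2 hlevel] with z hz
  exact (mult_mono hz).trans (hn x)

end Multiplicity

/-! ### The covering dimension -/

section CoveringDim

theorem Refines.refl (𝓤 : Set (Set X)) : Refines 𝓤 𝓤 :=
  fun U hU ↦ ⟨U, hU, subset_rfl⟩

theorem Refines.trans {𝓤 𝓥 𝓦 : Set (Set X)} (h : Refines 𝓦 𝓥) (h' : Refines 𝓥 𝓤) :
    Refines 𝓦 𝓤 := fun W hW ↦
  let ⟨V, hV, hWV⟩ := h W hW
  let ⟨U, hU, hVU⟩ := h' V hV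
  ⟨U, hU, hWV.trans hVU⟩

variable [TopologicalSpace X]

theorem coverDim_mono {𝓤 𝓥 : Set (Set X)} (h : Refines 𝓥 𝓤) : coverDim 𝓤 ≤ coverDim 𝓥 :=
  le_iInf₂ fun 𝓦 h𝓦 ↦ le_iInf fun href ↦ iInf₂_le_of_le 𝓦 h𝓦 (iInf_le _ (href.trans h))

theorem coverDim_le_coveringDim {𝓤 : Finset (Set X)} (h𝓤 : IsOpenCover 𝓤) :
    coverDim (𝓤 : Set (Set X)) ≤ coveringDim X :=
  le_iSup₂_of_le 𝓤 h𝓤 le_rfl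

theorem coverDim_le_of_ordAt_le {𝓥 : Finset (Set X)} {𝓤 : Set (Set X)} (h𝓥 : IsOpenCover 𝓥)
    (href : Refines 𝓥 𝓤) {n : ℕ} (hn : ∀ x, ordAt 𝓥 x ≤ n) : coverDim 𝓤 ≤ n :=
  iInf₂_le_of_le 𝓥 h𝓥 <| iInf_le_of_le href <| iSup_le fun x ↦ by exact_mod_cast hn x

theorem exists_refinement_of_coverDim_lt {𝓤 : Set (Set X)} {n : ℕ}
    (h : coverDim 𝓤 < (n + 1 : ℕ)) :
    ∃ 𝓥 : Finset (Set X), IsOpenCover 𝓥 ∧ Refines 𝓥 𝓤 ∧ ∀ x, ordAt 𝓥 x ≤ n := by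
  simp only [coverDim, iInf_lt_iff] at h
  obtain ⟨𝓥, h𝓥, href, hlt⟩ := h
  refine ⟨𝓥, h𝓥, href, fun x ↦ ordAt_le_natCast_iff.2 (Nat.lt_succ_iff.1 ?_)⟩
  have hx : ordAt 𝓥 x < (n + 1 : ℕ) := by
    exact_mod_cast (le_iSup (fun x ↦ (ordAt 𝓥 x : EReal)) x).trans_lt hlt
  rw [ordAt_eq_mult_sub_one, sub_lt_iff_lt_add] at hx
  exact_mod_cast hx

theorem coverDim_of_isEmpty [IsEmpty X] (𝓤 : Set (Set X)) : coverDim 𝓤 = ⊥ :=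
  eq_bot_iff.2 <| iInf₂_le_of_le ∅ ⟨by simp, isEmptyElim⟩ <| iInf_le_of_le (by simp [Refines]) <|
    by simp [ord]

theorem coveringDim_nonneg [Nonempty X] : 0 ≤ coveringDim X := by
  have huniv : IsOpenCover {(Set.univ : Set X)} := ⟨by simp, by simp⟩
  refine le_trans ?_ (coverDim_le_coveringDim huniv)
  refine le_iInf₂ fun 𝓥 h𝓥 ↦ le_iInf fun _ ↦ ?_
  obtain ⟨x⟩ := ‹Nonempty X›
  obtain ⟨V, hV, hx⟩ := h𝓥.2 x
  have hone : 1 ≤ mult ((↑) : 𝓥 → Set X) x := mult_pos (j := ⟨V, hV⟩) hx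
  refine le_iSup_of_le x ?_
  rw [EReal.coe_nonneg, ordAt_eq_mult_sub_one, sub_nonneg]
  exact_mod_cast hone

theorem exists_coveringDim_eq_natCast [Nonempty X] (hX : coveringDim X ≠ ⊤) :
    ∃ n : ℕ, coveringDim X = n := by
  obtain ⟨r, hr⟩ : ∃ r : ℝ, (r : EReal) = coveringDim X :=
    ⟨_, EReal.coe_toReal hX (EReal.bot_lt_zero.trans_le coveringDim_nonneg).ne'⟩
  have hr₀ : 0 ≤ r := by exact_mod_cast hr ▸ coveringDim_nonneg (X := X)
  refine ⟨⌊r⌋₊, le_antisymm (iSup₂_le fun 𝓤 h𝓤 ↦ ?_) ?_⟩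
  · have hlt : coverDim (𝓤 : Set (Set X)) < (⌊r⌋₊ + 1 : ℕ) :=
      (hr ▸ coverDim_le_coveringDim h𝓤).trans_lt (by exact_mod_cast Nat.lt_floor_add_one r)
    obtain ⟨𝓥, h𝓥, href, hn⟩ := exists_refinement_of_coverDim_lt hlt
    exact coverDim_le_of_ordAt_le h𝓥 href hn
  · rw [← hr]
    exact_mod_cast Nat.floor_le hr₀

theorem exists_shrinking_of_coveringDim_le {n : ℕ} (hX : coveringDim X ≤ n) {J : Type*} [Finite J]
    {A : J → Set X} (hA : ∀ j, IsOpen (A j)) (hcov : ∀ x, ∃ j, x ∈ A j) :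
    ∃ B : J → Set X, (∀ j, IsOpen (B j)) ∧ (∀ j, B j ⊆ A j) ∧ (∀ x, ∃ j, x ∈ B j) ∧
      ∀ x, mult B x ≤ n + 1 := by
  have hlt : coverDim ((Set.finite_range A).toFinset : Set (Set X)) < (n + 1 : ℕ) :=
    ((coverDim_le_coveringDim (isOpenCover_toFinset_range hA hcov)).trans hX).trans_lt
      (by exact_mod_cast n.lt_succ_self)
  obtain ⟨𝓥, h𝓥, href, hn⟩ := exists_refinement_of_coverDim_lt hlt
  choose f hf using fun V : 𝓥 ↦ show ∃ j, (V : Set X) ⊆ A j by simpa using href V V.2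
  refine ⟨fun j ↦ ⋃ (V : 𝓥) (_ : f V = j), V, fun j ↦ ?_, fun j ↦ ?_, fun x ↦ ?_, fun x ↦ ?_⟩
  · exact isOpen_iUnion fun V ↦ isOpen_iUnion fun _ ↦ h𝓥.1 V V.2
  · exact Set.iUnion₂_subset fun V hV ↦ hV ▸ hf V
  · obtain ⟨V, hV, hx⟩ := h𝓥.2 x
    exact ⟨f ⟨V, hV⟩, Set.mem_iUnion₂.2 ⟨⟨V, hV⟩, rfl, hx⟩⟩
  · have himage : {j | x ∈ ⋃ (V : 𝓥) (_ : f V = j), (V : Set X)} ⊆ f '' {V | x ∈ V.1} := by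
      intro j hj
      obtain ⟨V, hV, hx⟩ := Set.mem_iUnion₂.1 hj
      exact ⟨V, hx, hV⟩
    exact (Set.ncard_le_ncard himage).trans <| (Set.ncard_image_le (Set.toFinite _)).trans <|
      ordAt_le_natCast_iff.1 (hn x)

end CoveringDim

/-! ### Refining products of covers -/

section UpperCuts

variable {P : Type*} {u : P → ℝ} {σ τ : Set P}

/-- `σ` cuts off the largest values of `u`: all values of `u` on `σ` are positive and exceed all
values off `σ`. Ties straddling the cut are excluded, so `σ` is determined by its cardinality. -/
def IsUpperCut (u : P → ℝ) (σ : Set P) : Prop :=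
  (∀ p ∈ σ, 0 < u p) ∧ ∀ p ∈ σ, ∀ q ∉ σ, u q < u p

theorem IsUpperCut.eq_of_ncard_eq [Finite P] (hσ : IsUpperCut u σ) (hτ : IsUpperCut u τ)
    (h : σ.ncard = τ.ncard) : σ = τ := by
  have hchain : σ ⊆ τ ∨ τ ⊆ σ := by
    by_contra! hne
    obtain ⟨p, hp, hp'⟩ := Set.not_subset.1 hne.1
    obtain ⟨q, hq, hq'⟩ := Set.not_subset.1 hne.2
    exact lt_asymm (hσ.2 p hp q hq') (hτ.2 q hq p hp')
  rcases hchain with hsub | hsub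
  · exact Set.eq_of_subset_of_ncard_le hsub h.ge
  · exact (Set.eq_of_subset_of_ncard_le hsub h.le).symm

theorem ncard_isUpperCut_le [Finite P] {c n : ℕ} (hn : {p | 0 < u p}.ncard ≤ n + c) :
    {σ | IsUpperCut u σ ∧ c ≤ σ.ncard}.ncard ≤ n + 1 := by
  have hIcc : (Set.Icc c (n + c)).ncard = n + 1 := by
    rw [← Finset.coe_Icc, Set.ncard_coe_finset, Nat.card_Icc]
    omega
  rw [← hIcc]
  refine Set.ncard_le_ncard_of_injOn Set.ncard (fun σ hσ ↦ ⟨hσ.2, ?_⟩)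
    (fun σ hσ τ hτ ↦ hσ.1.eq_of_ncard_eq hτ.1) (Set.finite_Icc _ _)
  exact (Set.ncard_le_ncard hσ.1.1).trans hn

theorem isOpen_isUpperCut [TopologicalSpace X] [Finite P] {f : P → X → ℝ}
    (hf : ∀ p, Continuous (f p)) (σ : Set P) : IsOpen {x | IsUpperCut (f · x) σ} := by
  simp only [IsUpperCut, Set.ofPred_and, Set.ofPred_forall]
  refine .inter ?_ ?_
  · exact isOpen_iInter_of_finite fun p ↦ isOpen_iInter_of_finite fun _ ↦
      isOpen_lt continuous_const (hf p)
  · exact isOpen_iInter_of_finite fun p ↦ isOpen_iInter_of_finite fun _ ↦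
      isOpen_iInter_of_finite fun q ↦ isOpen_iInter_of_finite fun _ ↦ isOpen_lt (hf q) (hf p)

/-- Sorting the values at `x` of bump functions subordinate to `A` gives at most one upper cut of
each cardinality; the cuts meeting all covers have between `Nat.card ι` and `mult A x` elements. -/
theorem exists_refinement_of_mult_le [TopologicalSpace X] [NormalSpace X] {ι κ : Type*} [Finite ι]
    [Finite κ] {A : ι × κ → Set X} (hA : ∀ p, IsOpen (A p)) (hcov : ∀ i x, ∃ k, x ∈ A (i, k))
    {n : ℕ} (hn : ∀ x, mult A x ≤ n + Nat.card ι) :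
    ∃ 𝓦 : Finset (Set X), IsOpenCover 𝓦 ∧ (∀ W ∈ 𝓦, ∀ i, ∃ k, W ⊆ A (i, k)) ∧
      ∀ x, ordAt 𝓦 x ≤ n := by
  choose f hf using fun i ↦ BumpCovering.exists_isSubordinate_of_locallyFinite isClosed_univ
    (fun k ↦ A (i, k)) (fun k ↦ hA (i, k)) (locallyFinite_of_finite _)
    (fun x _ ↦ Set.mem_iUnion.2 (hcov i x))
  let u (p : ι × κ) (x : X) : ℝ := f p.1 p.2 x
  have hpos {p x} (h : 0 < u p x) : x ∈ A p := hf p.1 p.2 (subset_tsupport _ h.ne')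
  let S := {σ : Set (ι × κ) // ∀ i, ∃ k, (i, k) ∈ σ}
  let W (σ : S) : Set X := {x | IsUpperCut (u · x) σ.1}
  have hcard (σ : S) : Nat.card ι ≤ σ.1.ncard := by
    choose g hg using σ.2
    rw [← Set.ncard_univ]
    exact Set.ncard_le_ncard_of_injOn (fun i ↦ (i, g i)) (fun i _ ↦ hg i)
      fun i _ j _ h ↦ congrArg Prod.fst h
  refine ⟨(Set.finite_range W).toFinset, isOpenCover_toFinset_range
    (fun σ ↦ isOpen_isUpperCut (fun p ↦ (f p.1 p.2).continuous) σ.1) fun x ↦ ?_, ?_, fun x ↦ ?_⟩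
  · refine ⟨⟨{p | u p x = 1}, fun i ↦ ⟨(f i).ind x trivial, (f i).ind_apply x trivial⟩⟩,
      fun p hp ↦ ?_, fun p hp q hq ↦ ?_⟩
    · exact one_pos.trans_eq (Eq.symm hp)
    · exact (((f q.1).le_one q.2 x).lt_of_ne hq).trans_eq (Eq.symm hp)
  · rintro _ hW i
    obtain ⟨σ, rfl⟩ := (Set.finite_range W).mem_toFinset.1 hW
    obtain ⟨k, hk⟩ := σ.2 i
    exact ⟨k, fun x hx ↦ hpos (hx.1 _ hk)⟩
  · have hmult : mult W x ≤ n + 1 := calc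
      mult W x ≤ {σ | IsUpperCut (u · x) σ ∧ Nat.card ι ≤ σ.ncard}.ncard :=
          Set.ncard_le_ncard_of_injOn Subtype.val (fun σ hσ ↦ ⟨hσ, hcard σ⟩)
            Subtype.val_injective.injOn
      _ ≤ n + 1 := ncard_isUpperCut_le <|
          (Set.ncard_le_ncard (t := {p | x ∈ A p}) fun _ ↦ hpos).trans (hn x)
    refine (ordAt_toFinset_range_le W x).trans ?_
    rw [sub_le_iff_le_add]
    exact_mod_cast hmult

end UpperCuts

/-! ### Translates of a family -/

section Translates

variable [TopologicalSpace X] [Group Γ] (T : Γ →* (X ≃ₜ X)) {S : Type*}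

/-- The translates `T γ ⁻¹' A s` of the members of a family `A`, as a family indexed by `Γ × S`. -/
def translates (A : S → Set X) (p : Γ × S) : Set X :=
  T p.1 ⁻¹' A p.2

theorem mult_translates [Fintype Γ] [Finite S] (A : S → Set X) (x : X) :
    mult (translates T A) x = ∑ γ, mult A (T γ x) := by
  simp only [mult, ← Nat.card_coe_set_eq, Nat.card_congr (Equiv.setProdEquivSigma _),
    Nat.card_sigma]
  rfl

theorem sum_ordAt_apply [Fintype Γ] (𝓥 : Finset (Set X)) (x : X) :
    ∑ γ, ordAt 𝓥 (T γ x) = mult (translates T ((↑) : 𝓥 → Set X)) x - Nat.card Γ := by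
  simp [mult_translates, ordAt_eq_mult_sub_one]

end Translates

/-! ### Invariant measures -/

section Measure

variable [TopologicalSpace X] [MeasurableSpace X] [BorelSpace X]

theorem measurable_ordAt {𝓥 : Finset (Set X)} (h𝓥 : IsOpenCover 𝓥) : Measurable (ordAt 𝓥) :=
  measurable_const.add <| Finset.measurable_fun_sum _ fun V hV ↦
    measurable_const.indicator (h𝓥.1 V hV).measurableSet

theorem integrable_ordAt {𝓥 : Finset (Set X)} (h𝓥 : IsOpenCover 𝓥) (μ : Measure X)
    [IsFiniteMeasure μ] : Integrable (ordAt 𝓥) μ :=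
  (integrable_const _).add <| integrable_finsetSum _ fun V hV ↦
    (integrable_const _).indicator (h𝓥.1 V hV).measurableSet

variable [Group Γ] [Fintype Γ] (T : Γ →* (X ≃ₜ X))

theorem integral_le_of_orbit_sum_le {μ : ProbabilityMeasure X} (hμ : μ ∈ invProb T) {f : X → ℝ}
    (hf : Integrable f (μ : Measure X)) {r : ℝ} (hr : ∀ x, ∑ γ, f (T γ x) ≤ r) :
    ∫ x, f x ∂(μ : Measure X) ≤ r / Nat.card Γ := by
  have hmp (γ : Γ) : MeasurePreserving (T γ) (μ : Measure X) (μ : Measure X) :=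
    ⟨(T γ).measurable, hμ γ⟩
  have hint (γ : Γ) : Integrable (fun x ↦ f (T γ x)) (μ : Measure X) :=
    (hmp γ).integrable_comp_of_integrable hf
  rw [le_div_iff₀ (by exact_mod_cast Nat.card_pos)]
  calc (∫ x, f x ∂(μ : Measure X)) * Nat.card Γ
      = ∑ γ, ∫ x, f (T γ x) ∂(μ : Measure X) := by
        simp [fun γ ↦ (hmp γ).integral_comp (T γ).measurableEmbedding f, mul_comm]
    _ = ∫ x, ∑ γ, f (T γ x) ∂(μ : Measure X) := (integral_finsetSum _ fun γ _ ↦ hint γ).symm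
    _ ≤ ∫ _, r ∂(μ : Measure X) :=
        integral_mono (integrable_finsetSum _ fun γ _ ↦ hint γ) (integrable_const _) hr
    _ = r := by simp

/-- The image under `γ ↦ T γ x` of the uniform probability measure on `Γ`. -/
noncomputable def orbitMeasure (x : X) : Measure X :=
  (Nat.card Γ : ENNReal)⁻¹ • ∑ γ, Measure.dirac (T γ x)

instance isProbabilityMeasure_orbitMeasure (x : X) : IsProbabilityMeasure (orbitMeasure T x) where
  measure_univ := by simp [orbitMeasure, ENNReal.inv_mul_cancel]

theorem map_orbitMeasure (δ : Γ) (x : X) :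
    Measure.map (T δ) (orbitMeasure T x) = orbitMeasure T x := by
  rw [orbitMeasure, Measure.map_smul, ← Measure.mapₗ_apply_of_measurable (T δ).measurable, map_sum]
  congr 1
  refine Fintype.sum_equiv (Equiv.mulLeft δ) _ _ fun γ ↦ ?_
  rw [Measure.mapₗ_apply_of_measurable (T δ).measurable, Measure.map_dirac' (T δ).measurable]
  simp

omit [BorelSpace X] in
theorem integral_orbitMeasure {f : X → ℝ} (hf : Measurable f) (x : X) :
    ∫ y, f y ∂(orbitMeasure T x) = (∑ γ, f (T γ x)) / Nat.card Γ := by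
  rw [orbitMeasure, integral_smul_measure, integral_finsetSum_measure fun γ _ ↦
    integrable_dirac' hf.stronglyMeasurable (by simp)]
  simp [integral_dirac' _ _ hf.stronglyMeasurable, div_eq_inv_mul]

variable {𝓥 : Finset (Set X)}

theorem orbit_average_le_ordPair_invProb (h𝓥 : IsOpenCover 𝓥) (x : X) :
    (((∑ γ, ordAt 𝓥 (T γ x)) / Nat.card Γ : ℝ) : EReal) ≤ ordPair 𝓥 (invProb T) := by
  rw [← integral_orbitMeasure T (measurable_ordAt h𝓥)]
  exact le_iSup₂_of_le (⟨orbitMeasure T x, inferInstance⟩ : ProbabilityMeasure X)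
    (map_orbitMeasure T · x) le_rfl

theorem ordPair_invProb_le_of_orbit_sum_le (h𝓥 : IsOpenCover 𝓥) {r : ℝ}
    (hr : ∀ x, ∑ γ, ordAt 𝓥 (T γ x) ≤ r) :
    ordPair 𝓥 (invProb T) ≤ ((r / Nat.card Γ : ℝ) : EReal) :=
  iSup₂_le fun _ hμ ↦ EReal.coe_le_coe_iff.2 <|
    integral_le_of_orbit_sum_le T hμ (integrable_ordAt h𝓥 _) hr

end Measure

/-! ### The lower bound -/

theorem iSup_ereal_div {ι : Sort*} (f : ι → EReal) {c : EReal} (hc : 0 < c) (hc' : c ≠ ⊤) :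
    ⨆ i, f i / c = (⨆ i, f i) / c := by
  refine le_antisymm (iSup_le fun i ↦ EReal.div_le_div_right_of_nonneg hc.le (le_iSup f i)) ?_
  rw [EReal.div_le_iff_le_mul hc hc']
  exact iSup_le fun i ↦ (EReal.div_le_iff_le_mul hc hc').1 (le_iSup (f · / c) i)

section LowerBound

variable [TopologicalSpace X] [NormalSpace X] [MeasurableSpace X] [BorelSpace X] [Group Γ]
  [Finite Γ] (T : Γ →* (X ≃ₜ X))

theorem coverDim_div_card_le_ordPair {𝓥 : Finset (Set X)} (h𝓥 : IsOpenCover 𝓥) :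
    coverDim (𝓥 : Set (Set X)) / Nat.card Γ ≤ ordPair 𝓥 (invProb T) := by
  have := Fintype.ofFinite Γ
  have hΓ : (0 : EReal) < Nat.card Γ := by exact_mod_cast Nat.card_pos
  rcases isEmpty_or_nonempty X with _ | _
  · rw [coverDim_of_isEmpty, EReal.bot_div_of_pos_ne_top hΓ (EReal.natCast_ne_top _)]
    exact bot_le
  let A : Γ × 𝓥 → Set X := translates T (↑)
  have hcov (γ : Γ) (x : X) : ∃ V, x ∈ A (γ, V) :=
    let ⟨V, hV, hx⟩ := h𝓥.2 (T γ x)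
    ⟨⟨V, hV⟩, hx⟩
  obtain ⟨x₀, hmax⟩ := exists_forall_mult_le A
  have hge : Nat.card Γ ≤ mult A x₀ := by
    rw [mult_translates, Nat.card_eq_fintype_card, Fintype.card_eq_sum_ones]
    exact Finset.sum_le_sum fun γ _ ↦ mult_pos (hcov γ x₀).choose_spec
  obtain ⟨n, hn⟩ := Nat.exists_eq_add_of_le' hge
  obtain ⟨𝓦, h𝓦, href, hord⟩ := exists_refinement_of_mult_le
    (fun p ↦ (h𝓥.1 _ p.2.2).preimage (T p.1).continuous) hcov fun x ↦ (hmax x).trans hn.le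
  have hdim : coverDim (𝓥 : Set (Set X)) ≤ n :=
    coverDim_le_of_ordAt_le h𝓦 (fun W hW ↦
      let ⟨V, hV⟩ := href W hW 1
      ⟨V, V.2, fun x hx ↦ by simpa [A, translates] using hV hx⟩) hord
  have hsum : ∑ γ, ordAt 𝓥 (T γ x₀) = n := by
    rw [sum_ordAt_apply, hn]
    simp
  calc coverDim (𝓥 : Set (Set X)) / Nat.card Γ
      ≤ n / Nat.card Γ := EReal.div_le_div_right_of_nonneg hΓ.le hdim
    _ = (((∑ γ, ordAt 𝓥 (T γ x₀)) / Nat.card Γ : ℝ) : EReal) := by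
        rw [hsum, EReal.coe_div]
        rfl
    _ ≤ ordPair 𝓥 (invProb T) := orbit_average_le_ordPair_invProb T h𝓥 x₀

theorem coveringDim_div_card_le_dimSystem : coveringDim X / Nat.card Γ ≤ dimSystem T := by
  have hΓ : (0 : EReal) < Nat.card Γ := by exact_mod_cast Nat.card_pos
  simp only [coveringDim, ← iSup_ereal_div _ hΓ (EReal.natCast_ne_top _)]
  exact iSup₂_mono fun 𝓤 _ ↦ le_iInf₂ fun 𝓥 h𝓥 ↦ le_iInf fun href ↦
    (EReal.div_le_div_right_of_nonneg hΓ.le (coverDim_mono href)).trans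
      (coverDim_div_card_le_ordPair T h𝓥)

end LowerBound

/-! ### Families with disjoint translates -/

section DisjointTranslates

variable [TopologicalSpace X] [Group Γ] {T : Γ →* (X ≃ₜ X)} {S : Type*}

variable (T) in
/-- The translates `T γ ⁻¹' O` for `γ : Γ` are pairwise disjoint: `O` meets none of its nontrivial
translates, and in particular each orbit meets `O` in at most one point. -/
def DisjointTranslates (O : Set X) : Prop :=
  Pairwise fun γ δ ↦ Disjoint (T γ ⁻¹' O) (T δ ⁻¹' O)

theorem DisjointTranslates.eq_of_mem {O : Set X} (hO : DisjointTranslates T O) {γ δ : Γ} {x : X}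
    (hγ : T γ x ∈ O) (hδ : T δ x ∈ O) : γ = δ :=
  hO.eq (Set.not_disjoint_iff.2 ⟨x, hγ, hδ⟩)

theorem DisjointTranslates.mono {O O' : Set X} (hO : DisjointTranslates T O) (h : O' ⊆ O) :
    DisjointTranslates T O' :=
  fun _ _ hne ↦ (hO hne).mono (Set.preimage_mono h) (Set.preimage_mono h)

variable [Finite Γ]

theorem IsFreeAction.exists_mem_nhds_disjointTranslates [T2Space X] (hT : IsFreeAction T) (x : X) :
    ∃ O ∈ 𝓝 x, DisjointTranslates T O := by
  obtain ⟨W, hW, hdisj⟩ := (Set.finite_range fun γ ↦ T γ x).t2_separation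
  refine ⟨⋂ γ, T γ ⁻¹' W (T γ x), iInter_mem.2 fun γ ↦
    (T γ).continuous.continuousAt.preimage_mem_nhds ((hW _).2.mem_nhds (hW _).1),
    fun γ δ hne ↦ Set.disjoint_left.2 fun y hγ hδ ↦ ?_⟩
  have hγ' : y ∈ W (T γ⁻¹ x) := by simpa using Set.mem_iInter.1 hγ γ⁻¹
  have hδ' : y ∈ W (T δ⁻¹ x) := by simpa using Set.mem_iInter.1 hδ δ⁻¹
  exact Set.disjoint_left.1 (hdisj ⟨γ⁻¹, rfl⟩ ⟨δ⁻¹, rfl⟩ (hT x _ _ (inv_injective.ne hne))) hγ' hδ'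

theorem IsFreeAction.exists_finite_cover_disjointTranslates [T2Space X] [CompactSpace X]
    (hT : IsFreeAction T) {𝓤 : Finset (Set X)} (h𝓤 : IsOpenCover 𝓤) :
    ∃ (t : Finset X) (O : t → Set X), (∀ i, IsOpen (O i)) ∧ (∀ x, ∃ i, x ∈ O i) ∧
      (∀ i, DisjointTranslates T (O i)) ∧ ∀ p, ∃ U ∈ 𝓤, translates T O p ⊆ U := by
  choose N hN hdisj using hT.exists_mem_nhds_disjointTranslates
  choose U hU hxU using fun (x : X) γ ↦ h𝓤.2 (T γ x)
  have hnhds (x : X) : N x ∩ ⋂ γ, T γ ⁻¹' U x γ ∈ 𝓝 x :=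
    inter_mem (hN x) <| iInter_mem.2 fun γ ↦
      ((h𝓤.1 _ (hU x γ)).preimage (T γ).continuous).mem_nhds (hxU x γ)
  choose O hON hO hxO using fun x ↦ mem_nhds_iff.1 (hnhds x)
  obtain ⟨t, ht⟩ := CompactSpace.elim_nhds_subcover O fun x ↦ (hO x).mem_nhds (hxO x)
  refine ⟨t, fun i ↦ O i, fun i ↦ hO i, fun x ↦ ?_,
    fun i ↦ (hdisj i).mono ((hON i).trans Set.inter_subset_left),
    fun ⟨γ, i⟩ ↦ ⟨U i γ⁻¹, hU i γ⁻¹, fun y hy ↦ ?_⟩⟩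
  · obtain ⟨i, hi, hx⟩ := Set.mem_iUnion₂.1 (ht.ge (Set.mem_univ x))
    exact ⟨⟨i, hi⟩, hx⟩
  · simpa using Set.mem_iInter.1 (hON i hy).2 γ⁻¹

/-- Over the saturation `D` of `C` the family `A` is replaced by a shrinking of its translates;
disjointness of the translates of `O` ensures that each point of `C` sees only one of these. -/
theorem exists_shrinking_translates_on {n : ℕ} (hX : coveringDim X ≤ n) [Finite S]
    {A : S → Set X} (hA : ∀ s, IsOpen (A s)) (hcov : ∀ x, ∃ p, x ∈ translates T A p)
    {C O : Set X} (hC : IsClosed C) (hO : IsOpen O) (hCO : C ⊆ O) (hd : DisjointTranslates T O) :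
    ∃ B : S → Set X, (∀ s, IsOpen (B s)) ∧ (∀ s, B s ⊆ A s) ∧
      (∀ x, ∃ p, x ∈ translates T B p) ∧ ∀ x ∈ C, mult (translates T B) x ≤ n + 1 := by
  obtain ⟨V, hV, hVA, hVcov, hVn⟩ := exists_shrinking_of_coveringDim_le hX
    (fun p : Γ × S ↦ (hA p.2).preimage (T p.1).continuous) hcov
  let D : Set X := ⋃ γ, T γ '' C
  have hD : IsClosed D := isClosed_iUnion_of_finite fun γ ↦ (T γ).isClosedMap _ hC
  have hmemD {γ x} (hx : T γ x ∈ D) : x ∈ D := by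
    obtain ⟨δ, y, hy, hyx⟩ := Set.mem_iUnion.1 hx
    exact Set.mem_iUnion.2 ⟨γ⁻¹ * δ, y, hy, by simp [hyx]⟩
  refine ⟨fun s ↦ (A s \ D) ∪ ⋃ γ, T γ '' (V (γ, s) ∩ O), fun s ↦ ?_, fun s ↦ ?_, fun x ↦ ?_,
    fun x hx ↦ (mult_mono fun p hp ↦ ?_).trans (hVn x)⟩
  · exact ((hA s).sdiff hD).union (isOpen_iUnion fun γ ↦ (T γ).isOpenMap _ ((hV _).inter hO))
  · refine Set.union_subset Set.sdiff_subset (Set.iUnion_subset fun γ ↦ ?_)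
    exact Set.image_subset_iff.2 (Set.inter_subset_left.trans (hVA (γ, s)))
  · by_cases hx : x ∈ D
    · obtain ⟨γ, y, hy, rfl⟩ := Set.mem_iUnion.1 hx
      obtain ⟨⟨δ, s⟩, hyV⟩ := hVcov y
      exact ⟨(δ * γ⁻¹, s), .inr (Set.mem_iUnion.2 ⟨δ, y, ⟨hyV, hCO hy⟩, by simp⟩)⟩
    · obtain ⟨⟨γ, s⟩, hxs⟩ := hcov x
      exact ⟨(γ, s), .inl ⟨hxs, mt hmemD hx⟩⟩
  · rcases hp with hp | hp
    · exact (hp.2 (Set.mem_iUnion.2 ⟨p.1, x, hx, rfl⟩)).elim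
    · obtain ⟨δ, y, hy, hyx⟩ := Set.mem_iUnion.1 hp
      have hmem : T (δ⁻¹ * p.1) x ∈ O := by simpa [← hyx] using hy.2
      obtain rfl : δ = p.1 := inv_mul_eq_one.1 (hd.eq_of_mem hmem (by simpa using hCO hx))
      exact (T p.1).injective hyx ▸ hy.1

theorem exists_shrinking_translates {n : ℕ} (hX : coveringDim X ≤ n) [Finite S]
    {A : S → Set X} (hA : ∀ s, IsOpen (A s)) (hcov : ∀ x, ∃ p, x ∈ translates T A p)
    {ι : Type*} (t : Finset ι) {C O : ι → Set X} (hC : ∀ i, IsClosed (C i))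
    (hO : ∀ i, IsOpen (O i)) (hCO : ∀ i, C i ⊆ O i) (hd : ∀ i, DisjointTranslates T (O i)) :
    ∃ B : S → Set X, (∀ s, IsOpen (B s)) ∧ (∀ s, B s ⊆ A s) ∧
      (∀ x, ∃ p, x ∈ translates T B p) ∧
      ∀ i ∈ t, ∀ x ∈ C i, mult (translates T B) x ≤ n + 1 := by
  classical
  induction t using Finset.induction_on with
  | empty => exact ⟨A, hA, fun _ ↦ subset_rfl, hcov, by simp⟩
  | insert i t _ ih =>
    obtain ⟨B, hB, hBA, hBcov, hBn⟩ := ih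
    obtain ⟨B', hB', hBB', hBcov', hBn'⟩ :=
      exists_shrinking_translates_on hX hB hBcov (hC i) (hO i) (hCO i) (hd i)
    refine ⟨B', hB', fun s ↦ (hBB' s).trans (hBA s), hBcov', fun j hj x hx ↦ ?_⟩
    rcases Finset.mem_insert.1 hj with rfl | hj
    · exact hBn' x hx
    · exact (mult_mono fun p hp ↦ hBB' p.2 hp).trans (hBn j hj x hx)

theorem exists_shrinking_of_disjointTranslates [NormalSpace X] {n : ℕ} (hX : coveringDim X ≤ n)
    [Finite S] {O : S → Set X} (hO : ∀ s, IsOpen (O s)) (hcov : ∀ x, ∃ s, x ∈ O s)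
    (hd : ∀ s, DisjointTranslates T (O s)) :
    ∃ A : S → Set X, (∀ s, IsOpen (A s)) ∧ (∀ s, A s ⊆ O s) ∧
      (∀ x, ∃ p, x ∈ translates T A p) ∧ ∀ x, mult (translates T A) x ≤ n + 1 := by
  have := Fintype.ofFinite S
  obtain ⟨C, hCcov, hC, hCO⟩ := exists_iUnion_eq_closed_subset hO (fun _ ↦ Set.toFinite _)
    (Set.iUnion_eq_univ_iff.2 hcov)
  have hcov' (x : X) : ∃ p : Γ × S, x ∈ translates T O p :=
    (hcov x).imp' (Prod.mk 1) fun s hs ↦ by simpa [translates] using hs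
  obtain ⟨A, hA, hAO, hAcov, hAn⟩ :=
    exists_shrinking_translates hX hO hcov' Finset.univ hC hO hCO hd
  refine ⟨A, hA, hAO, hAcov, fun x ↦ ?_⟩
  obtain ⟨s, hs⟩ := Set.iUnion_eq_univ_iff.1 hCcov x
  exact hAn s (Finset.mem_univ s) x hs

end DisjointTranslates

/-! ### Relative heights -/

section RelativeHeight

variable {P : Type*} {g : P → X → ℝ}

/-- The ratio of `g p` to the pointwise maximum of the family `g`. It is used for families with a
positive value at each point, where the division is not by zero. -/
noncomputable def relativeHeight (g : P → X → ℝ) (p : P) (x : X) : ℝ :=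
  g p x / ⨆ q, g q x

variable [Finite P]

theorem le_iSup_apply (g : P → X → ℝ) (p : P) (x : X) : g p x ≤ ⨆ q, g q x :=
  le_ciSup (Set.finite_range fun q ↦ g q x).bddAbove p

theorem iSup_apply_pos {x : X} (hx : ∃ p, 0 < g p x) : 0 < ⨆ q, g q x :=
  let ⟨p, hp⟩ := hx
  hp.trans_le (le_iSup_apply g p x)

theorem one_le_relativeHeight_iff {x : X} (hx : ∃ p, 0 < g p x) {p : P} :
    1 ≤ relativeHeight g p x ↔ g p x = ⨆ q, g q x := by
  rw [relativeHeight, one_le_div (iSup_apply_pos hx), (le_iSup_apply g p x).ge_iff_eq]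

theorem exists_one_le_relativeHeight {x : X} (hx : ∃ p, 0 < g p x) :
    ∃ p, 1 ≤ relativeHeight g p x := by
  have : Nonempty P := hx.nonempty
  simpa only [one_le_relativeHeight_iff hx] using exists_eq_ciSup_of_finite (f := fun q ↦ g q x)

theorem pos_of_relativeHeight_pos {x : X} (hx : ∃ p, 0 < g p x) {p : P}
    (hp : 0 < relativeHeight g p x) : 0 < g p x :=
  (div_pos_iff_of_pos_right (iSup_apply_pos hx)).1 hp

theorem continuous_relativeHeight [TopologicalSpace X] (hg : ∀ p, Continuous (g p))
    (hpos : ∀ x, ∃ p, 0 < g p x) (p : P) : Continuous (relativeHeight g p) := by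
  have := Fintype.ofFinite P
  have hsup : Continuous fun x ↦ ⨆ q, g q x := by
    have : Nonempty P := ⟨p⟩
    simp only [← Finset.sup'_univ_eq_ciSup]
    exact Continuous.finset_sup'_apply _ fun q _ ↦ hg q
  exact (hg p).div hsup fun x ↦ (iSup_apply_pos (hpos x)).ne'

end RelativeHeight

/-! ### The upper bound -/

section ScaledTranslates

variable [TopologicalSpace X] [Group Γ] {T : Γ →* (X ≃ₜ X)} {S : Type*}

variable (T) in
/-- The translates of the functions `φ s`, scaled by the positive factors `exp (b p)`. For generic
`b` this removes coincidences between the values along an orbit. -/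
noncomputable def scaledTranslates (b : Γ × S → ℝ) (φ : S → X → ℝ) (p : Γ × S) (x : X) : ℝ :=
  Real.exp (b p) * φ p.2 (T p.1 x)

theorem scaledTranslates_pos_iff {b : Γ × S → ℝ} {φ : S → X → ℝ} {p : Γ × S} {x : X} :
    0 < scaledTranslates T b φ p x ↔ 0 < φ p.2 (T p.1 x) :=
  mul_pos_iff_of_pos_left (Real.exp_pos _)

variable [Finite Γ] [Finite S]

theorem exists_continuous_pos_of_translates_cover [NormalSpace X] {A : S → Set X}
    (hA : ∀ s, IsOpen (A s)) (hcov : ∀ x, ∃ p, x ∈ translates T A p) :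
    ∃ φ : S → X → ℝ, (∀ s, Continuous (φ s)) ∧ (∀ s, {x | 0 < φ s x} ⊆ A s) ∧
      ∀ x, ∃ p : Γ × S, 0 < φ p.2 (T p.1 x) := by
  obtain ⟨C, hCcov, hC, hCA⟩ := exists_iUnion_eq_closed_subset
    (fun p : Γ × S ↦ (hA p.2).preimage (T p.1).continuous) (fun _ ↦ Set.toFinite _)
    (Set.iUnion_eq_univ_iff.2 hcov)
  let D (s : S) : Set X := ⋃ γ, T γ '' C (γ, s)
  have hD (s : S) : IsClosed (D s) :=
    isClosed_iUnion_of_finite fun γ ↦ (T γ).isClosedMap _ (hC _)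
  have hDA (s : S) : D s ⊆ A s :=
    Set.iUnion_subset fun γ ↦ Set.image_subset_iff.2 (hCA (γ, s))
  choose φ hφ₀ hφ₁ _ using fun s ↦ exists_continuous_zero_one_of_isClosed
    (hA s).isClosed_compl (hD s) (Set.disjoint_compl_left_iff_subset.2 (hDA s))
  refine ⟨fun s ↦ φ s, fun s ↦ (φ s).continuous, fun s x hx ↦ ?_, fun x ↦ ?_⟩
  · by_contra hxA
    exact hx.ne' (hφ₀ s hxA)
  · obtain ⟨p, hp⟩ := Set.iUnion_eq_univ_iff.1 hCcov x
    exact ⟨p, one_pos.trans_eq (hφ₁ p.2 (Set.mem_iUnion.2 ⟨p.1, x, hp, rfl⟩)).symm⟩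

theorem mult_maximal_scaledTranslates_le {b : Γ × S → ℝ} (hb : LinearIndependent ℚ b)
    {φ : S → X → ℝ} (hd : ∀ s, DisjointTranslates T {x | 0 < φ s x})
    (hpos : ∀ x, ∃ p : Γ × S, 0 < φ p.2 (T p.1 x)) {n : ℕ} {x : X}
    (hn : mult (translates T fun s ↦ {x | 0 < φ s x}) x ≤ n + 1) :
    mult (translates T fun p ↦ {y | 1 ≤ relativeHeight (scaledTranslates T b φ) p y}) x ≤
      Nat.card Γ + n := by
  have hpos' (y : X) : ∃ p, 0 < scaledTranslates T b φ p y := by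
    simpa only [scaledTranslates_pos_iff] using hpos y
  have hlt := ncard_ties_lt hb (u := fun p ↦ φ p.2 (T p.1 x)) (hpos x)
    (fun s _ _ ↦ (hd s).eq_of_mem) (m := fun δ ↦ ⨆ q, scaledTranslates T b φ q (T δ x))
    fun δ ↦ iSup_apply_pos (hpos' _)
  have hmax : mult (translates T fun p ↦ {y | 1 ≤ relativeHeight (scaledTranslates T b φ) p y}) x =
      {q : Γ × Γ × S | Real.exp (b q.2) * φ q.2.2 (T (q.2.1 * q.1) x) =
        ⨆ p, scaledTranslates T b φ p (T q.1 x)}.ncard := by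
    simp only [mult, translates, Set.mem_preimage, Set.mem_ofPred_eq,
      one_le_relativeHeight_iff (hpos' _), map_mul, Homeomorph.mul_apply]
    rfl
  rw [hmax]
  exact Nat.lt_succ_iff.1 (hlt.trans_le (Nat.add_le_add_left hn _))

theorem exists_cover_mult_translates_le [NormalSpace X] [CompactSpace X] {A : S → Set X}
    (hA : ∀ s, IsOpen (A s)) (hcov : ∀ x, ∃ p, x ∈ translates T A p)
    (hd : ∀ s, DisjointTranslates T (A s)) {n : ℕ} (hn : ∀ x, mult (translates T A) x ≤ n + 1) :
    ∃ V : Γ × S → Set X, (∀ p, IsOpen (V p)) ∧ (∀ p, V p ⊆ translates T A p) ∧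
      (∀ x, ∃ p, x ∈ V p) ∧ ∀ x, mult (translates T V) x ≤ Nat.card Γ + n := by
  obtain ⟨φ, hφ, hφA, hpos⟩ := exists_continuous_pos_of_translates_cover hA hcov
  obtain ⟨b, hb⟩ := exists_linearIndependent_of_aleph0_le_rank
    (Real.rank_rat_real ▸ Cardinal.aleph0_le_continuum) (Γ × S)
  let g := scaledTranslates T b φ
  have hgpos (x : X) : ∃ p, 0 < g p x := by
    simpa only [g, scaledTranslates_pos_iff] using hpos x
  have hg : ∀ p, Continuous (relativeHeight g p) := continuous_relativeHeight
    (fun p ↦ continuous_const.mul ((hφ p.2).comp (T p.1).continuous)) hgpos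
  have hties (x : X) : mult (translates T fun p ↦ {y | 1 ≤ relativeHeight g p y}) x ≤
      Nat.card Γ + n :=
    mult_maximal_scaledTranslates_le hb (fun s ↦ (hd s).mono (hφA s)) hpos
      ((mult_mono fun p hp ↦ hφA p.2 hp).trans (hn x))
  have hlevel := eventually_mult_superlevel_le (J := Γ × Γ × S)
    (fun q ↦ (hg q.2).comp (T q.1).continuous) hties
  obtain ⟨r, hr, hr₀, hr₁⟩ := ((hlevel.filter_mono nhdsWithin_le_nhds).and
    (Ioo_mem_nhdsLT (zero_lt_one' ℝ))).exists
  refine ⟨fun p ↦ {x | r < relativeHeight g p x}, fun p ↦ isOpen_lt continuous_const (hg p),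
    fun p x hx ↦ ?_, fun x ↦ ?_, hr⟩
  · exact hφA p.2 (scaledTranslates_pos_iff.1 (pos_of_relativeHeight_pos (hgpos x) (hr₀.trans hx)))
  · exact (exists_one_le_relativeHeight (hgpos x)).imp fun p hp ↦ hr₁.trans_le hp

end ScaledTranslates

section UpperBound

variable [TopologicalSpace X] [T2Space X] [CompactSpace X] [MeasurableSpace X] [BorelSpace X]
  [Group Γ] [Finite Γ] {T : Γ →* (X ≃ₜ X)}

theorem dimSystem_le_of_coveringDim_le (hT : IsFreeAction T) {n : ℕ} (hX : coveringDim X ≤ n) :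
    dimSystem T ≤ ((n / Nat.card Γ : ℝ) : EReal) := by
  have := Fintype.ofFinite Γ
  refine iSup₂_le fun 𝓤 h𝓤 ↦ ?_
  obtain ⟨t, O, hO, hOcov, hd, hO𝓤⟩ := hT.exists_finite_cover_disjointTranslates h𝓤
  obtain ⟨A, hA, hAO, hAcov, hAn⟩ := exists_shrinking_of_disjointTranslates hX hO hOcov hd
  obtain ⟨V, hV, hVA, hVcov, hVn⟩ :=
    exists_cover_mult_translates_le hA hAcov (fun s ↦ (hd s).mono (hAO s)) hAn
  let 𝓥 := (Set.finite_range V).toFinset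
  have h𝓥 : IsOpenCover 𝓥 := isOpenCover_toFinset_range hV hVcov
  have href : Refines (𝓥 : Set (Set X)) 𝓤 := by
    intro W hW
    obtain ⟨p, rfl⟩ := (Set.finite_range V).mem_toFinset.1 hW
    obtain ⟨U, hU, hOU⟩ := hO𝓤 p
    exact ⟨U, hU, (hVA p).trans ((Set.preimage_mono (hAO p.2)).trans hOU)⟩
  refine iInf₂_le_of_le 𝓥 h𝓥 <| iInf_le_of_le href <|
    ordPair_invProb_le_of_orbit_sum_le T h𝓥 fun x ↦ ?_
  calc ∑ γ, ordAt 𝓥 (T γ x) ≤ ∑ γ, ((mult V (T γ x) : ℝ) - 1) :=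
        Finset.sum_le_sum fun γ _ ↦ ordAt_toFinset_range_le V (T γ x)
    _ = (mult (translates T V) x : ℝ) - Nat.card Γ := by simp [mult_translates]
    _ ≤ n := by
        rw [sub_le_iff_le_add']
        exact_mod_cast hVn x

omit [T2Space X] [CompactSpace X] [BorelSpace X] [Finite Γ] in
theorem dimSystem_of_isEmpty [IsEmpty X] : dimSystem T = ⊥ :=
  eq_bot_iff.2 <| iSup₂_le fun 𝓤 h𝓤 ↦ iInf₂_le_of_le 𝓤 h𝓤 <| iInf_le_of_le (Refines.refl _) <|
    iSup₂_le fun μ _ ↦ isEmptyElim μ.nonempty.some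

theorem dimSystem_le_coveringDim_div_card (hT : IsFreeAction T) :
    dimSystem T ≤ coveringDim X / Nat.card Γ := by
  rcases isEmpty_or_nonempty X with _ | _
  · exact dimSystem_of_isEmpty.trans_le bot_le
  by_cases htop : coveringDim X = ⊤
  · rw [htop, EReal.top_div_of_pos_ne_top (by exact_mod_cast Nat.card_pos) (EReal.natCast_ne_top _)]
    exact le_top
  obtain ⟨n, hn⟩ := exists_coveringDim_eq_natCast htop
  rw [hn]
  simpa [EReal.coe_div] using dimSystem_le_of_coveringDim_le hT hn.le

end UpperBound

/-! ### Mean dimension -/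

section Folner

open scoped Pointwise

variable [Group Γ]

theorem eq_univ_of_forall_smul_eq {s : Set Γ} (hs : s.Nonempty) (h : ∀ g : Γ, g • s = s) :
    s = Set.univ := by
  obtain ⟨a, ha⟩ := hs
  refine Set.eq_univ_of_forall fun b ↦ ?_
  rw [← h (b * a⁻¹)]
  exact ⟨a, ha, by simp⟩

theorem one_le_count_symmDiff [MeasurableSpace X] [MeasurableSingletonClass X] {s t : Set X}
    (h : s ≠ t) : 1 ≤ Measure.count (symmDiff s t) := by
  obtain ⟨a, ha⟩ := Set.symmDiff_nonempty.2 h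
  rw [← Measure.count_singleton a]
  exact measure_mono (Set.singleton_subset_iff.2 ha)

/-- A nonempty `F n` that is not invariant under some `g` satisfies
`|g F n ∆ F n| / |F n| ≥ 1 / |Γ|`. -/
theorem IsFolnerSeq.eventually_eq_univ [Fintype Γ] {F : ℕ → Finset Γ} (hF : IsFolnerSeq F) :
    ∀ᶠ n in atTop, F n = Finset.univ := by
  let _ : MeasurableSpace Γ := ⊤
  have : DiscreteMeasurableSpace Γ := ⟨fun _ ↦ trivial⟩
  have hF' : IsFoelner Γ (Measure.count : Measure Γ) atTop (fun n ↦ (F n : Set Γ)) := hF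
  have hsmall (g : Γ) : ∀ᶠ n in atTop,
      Measure.count (symmDiff (g • (F n : Set Γ)) (F n)) / Measure.count (F n : Set Γ) <
        (Fintype.card Γ : ENNReal)⁻¹ :=
    (hF'.tendsto_meas_smul_symmDiff g).eventually_lt_const (by simp)
  filter_upwards [hF'.eventually_meas_ne_zero, eventually_all.2 hsmall] with n hne hn
  have hinv (g : Γ) : g • (F n : Set Γ) = F n := by
    by_contra hg
    refine (hn g).not_ge ?_
    rw [Measure.count_apply_finset, ← one_div]
    exact ENNReal.div_le_div (one_le_count_symmDiff hg) (by exact_mod_cast Finset.card_le_univ _)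
  have hnonempty : (F n : Set Γ).Nonempty := nonempty_of_measure_ne_zero hne
  exact Finset.coe_eq_univ.1 (eq_univ_of_forall_smul_eq hnonempty hinv)

end Folner

section MeanDim

variable [TopologicalSpace X] [Group Γ] (T : Γ →* (X ≃ₜ X))

theorem refines_join {F : Finset Γ} (hF : 1 ∈ F) (𝓤 : Set (Set X)) : Refines (join T F 𝓤) 𝓤 := by
  rintro _ ⟨U, hU, rfl⟩
  exact ⟨U 1, hU 1 hF, fun x hx ↦ by simpa using Set.mem_iInter₂.1 hx 1 hF⟩

section Join

variable [Fintype Γ]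

theorem exists_isOpenCover_coe_eq_join {𝓤 : Finset (Set X)} (h𝓤 : IsOpenCover 𝓤) :
    ∃ 𝓦 : Finset (Set X), IsOpenCover 𝓦 ∧ (𝓦 : Set (Set X)) = join T Finset.univ 𝓤 := by
  refine ⟨_, isOpenCover_toFinset_range (A := fun U : Γ → 𝓤 ↦ ⋂ γ, T γ '' (U γ : Set X))
    (fun U ↦ ?_) (fun x ↦ ?_), ?_⟩
  · exact isOpen_iInter_of_finite fun γ ↦ (T γ).isOpenMap _ (h𝓤.1 _ (U γ).2)
  · choose U hU hx using fun γ ↦ h𝓤.2 ((T γ).symm x)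
    exact ⟨fun γ ↦ ⟨U γ, hU γ⟩, Set.mem_iInter.2 fun γ ↦ ⟨_, hx γ, by simp⟩⟩
  · ext W
    rw [Set.Finite.coe_toFinset]
    constructor
    · rintro ⟨U, rfl⟩
      exact ⟨fun γ ↦ U γ, fun γ _ ↦ (U γ).2, by simp⟩
    · rintro ⟨U, hU, rfl⟩
      exact ⟨fun γ ↦ ⟨U γ, hU γ (Finset.mem_univ γ)⟩, by simp⟩

theorem iSup_coverDim_join :
    ⨆ (𝓤 : Finset (Set X)) (_ : IsOpenCover 𝓤), coverDim (join T Finset.univ 𝓤) =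
      coveringDim X := by
  refine le_antisymm (iSup₂_le fun 𝓤 h𝓤 ↦ ?_)
    (iSup₂_mono fun 𝓤 _ ↦ coverDim_mono (refines_join T (Finset.mem_univ 1) _))
  obtain ⟨𝓦, h𝓦, hjoin⟩ := exists_isOpenCover_coe_eq_join T h𝓤
  exact hjoin ▸ coverDim_le_coveringDim h𝓦

theorem tendsto_avgCoverDim {F : ℕ → Finset Γ} (hF : IsFolnerSeq F) (𝓤 : Set (Set X)) :
    Tendsto (fun n ↦ avgCoverDim T 𝓤 (F n)) atTop
      (𝓝 (coverDim (join T Finset.univ 𝓤) / Nat.card Γ)) := by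
  refine tendsto_const_nhds.congr' ?_
  filter_upwards [hF.eventually_eq_univ] with n hn
  rw [hn, avgCoverDim, Finset.card_univ, Nat.card_eq_fintype_card]

end Join

theorem meanDim_eq_coveringDim_div_card [Finite Γ] {F : ℕ → Finset Γ} (hF : IsFolnerSeq F) :
    meanDim T F = coveringDim X / Nat.card Γ := by
  have := Fintype.ofFinite Γ
  have hΓ : (0 : EReal) < Nat.card Γ := by exact_mod_cast Nat.card_pos
  simp only [meanDim, (tendsto_avgCoverDim T hF _).limsup_eq,
    iSup_ereal_div _ hΓ (EReal.natCast_ne_top _), iSup_coverDim_join]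

end MeanDim

end MeasDim

theorem theorem7p1_general {Γ : Type*} [Group Γ] [Finite Γ]
    {X : Type*} [TopologicalSpace X] [T2Space X] [CompactSpace X] [MeasurableSpace X]
    [BorelSpace X] (T : Γ →* (X ≃ₜ X)) (hT : MeasDim.IsFreeAction T) :
    MeasDim.dimSystem T = MeasDim.coveringDim X / (Nat.card Γ : EReal) ∧
    ∀ F : ℕ → Finset Γ, MeasDim.IsFolnerSeq F →
      (∀ 𝓤 : Finset (Set X), MeasDim.IsOpenCover 𝓤 →
        ∃ l : EReal, Tendsto (fun n => MeasDim.avgCoverDim T (𝓤 : Set (Set X)) (F n))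
          atTop (𝓝 l)) ∧
      MeasDim.meanDim T F = MeasDim.dimSystem T := by
  have := Fintype.ofFinite Γ
  have hdim : MeasDim.dimSystem T = MeasDim.coveringDim X / Nat.card Γ :=
    (MeasDim.dimSystem_le_coveringDim_div_card hT).antisymm
      (MeasDim.coveringDim_div_card_le_dimSystem T)
  exact ⟨hdim, fun F hF ↦ ⟨fun 𝓤 _ ↦ ⟨_, MeasDim.tendsto_avgCoverDim T hF 𝓤⟩,
    (MeasDim.meanDim_eq_coveringDim_div_card T hF).trans hdim.symm⟩⟩

theorem theorem7p1 {Γ : Type*} [Group Γ] [Finite Γ]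
    {X : Type*} [MetricSpace X] [CompactSpace X] [MeasurableSpace X] [BorelSpace X]
    (T : Γ →* (X ≃ₜ X)) (hT : MeasDim.IsFreeAction T) :
    MeasDim.dimSystem T = MeasDim.coveringDim X / (Nat.card Γ : EReal) ∧
    ∀ F : ℕ → Finset Γ, MeasDim.IsFolnerSeq F →
      (∀ 𝓤 : Finset (Set X), MeasDim.IsOpenCover 𝓤 →
        ∃ l : EReal, Tendsto (fun n => MeasDim.avgCoverDim T (𝓤 : Set (Set X)) (F n))
          atTop (𝓝 l)) ∧
      MeasDim.meanDim T F = MeasDim.dimSystem T :=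
  theorem7p1_general T hT
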